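/- Let $G=(V,E)$ be a finite simple graph, and let $\mathcal D_G^1$ be the family of edge sets of all spanning subgraphs of $G$ with minimum degree at least $1$. In the strong positive minimum degree game $(E(G),\mathcal D_G^1)$, two players, Red and Blue, alternately claim one previously unclaimed edge of $G$, with Red going first; the winner is the first player to fully claim some member of $\mathcal D_G^1$, and the game is a draw if all edges have been claimed and neither player has done so. Theorem. For every positive integer $m$ there exists an integer $n_0=n_0(m)$ such that, for every $n\ge n_0$ and every graph $G$ on $n$ vertices with minimum degree $\delta(G)\ge n-m$, Red has a strategy for winning the strong positive minimum degree game $(E(G),\mathcal D_G^1)$ within at most $\lfloor n/2\rfloor+1$ of his own moves, against any play of Blue. -/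

import Mathlib

/-! ### Strong (Maker-Maker) games

A game `(X, F)` has a board `X` and a family `F` of winning sets. Red and Blue alternately claim
one previously unclaimed element of the board, Red going first. A history is the chronological
list of all elements claimed so far, so Red's moves stand at the positions `0, 2, 4, …` and
Blue's moves at the positions `1, 3, 5, …`. -/

namespace StrongGame

variable {α : Type*}

/-- The set of elements claimed by Red in the history `h`. -/
def redClaimed (h : List α) : Set α := {e | ∃ i : ℕ, h[2 * i]? = some e}

/-- The set of elements claimed by Blue in the history `h`. -/
def blueClaimed (h : List α) : Set α := {e | ∃ i : ℕ, h[2 * i + 1]? = some e}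

/-- The number of moves made by Red in the history `h`. -/
def redMoveCount (h : List α) : ℕ := (h.length + 1) / 2

/-- It is Red's turn to move after the history `h`. -/
def RedToMove (h : List α) : Prop := Even h.length

/-- A player who has claimed the elements of `S` has fully claimed some winning set. -/
def Completes (F : Set (Set α)) (S : Set α) : Prop := ∃ A ∈ F, A ⊆ S

/-- The game is over: one of the players has fully claimed a winning set, or every element of the
board has been claimed. -/
def IsOver (X : Set α) (F : Set (Set α)) (h : List α) : Prop :=
  Completes F (redClaimed h) ∨ Completes F (blueClaimed h) ∨ ∀ e ∈ X, e ∈ h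

/-- Red has won. Play stops as soon as some player has fully claimed a winning set, so in a play
of the game this says that Red was the first player to do so. -/
def RedWins (F : Set (Set α)) (h : List α) : Prop :=
  Completes F (redClaimed h) ∧ ¬ Completes F (blueClaimed h)

/-- `h` is a (partial or complete) play of the strong game `(X, F)`: every move claims an
unclaimed element of the board, and no move is made after the game is over. -/
inductive IsPlay (X : Set α) (F : Set (Set α)) : List α → Prop
  | nil : IsPlay X F []
  | move {h : List α} {e : α} (hplay : IsPlay X F h) (hover : ¬ IsOver X F h)
      (hX : e ∈ X) (hfree : e ∉ h) : IsPlay X F (h ++ [e])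

/-- A strategy for Red tells him, for every history, which element to claim next. -/
abbrev Strategy (α : Type*) := List α → α

/-- In the history `h`, Red has made all of his moves according to the strategy `σ`. -/
def Follows (σ : Strategy α) (h : List α) : Prop :=
  ∀ (i : ℕ) (e : α), h[2 * i]? = some e → e = σ (h.take (2 * i))

/-- `σ` wins the strong game `(X, F)` for Red within at most `t` moves of Red. In every play in
which Red follows `σ` (and Blue moves in any way whatsoever): Red makes at most `t` moves; if the
game is over then Red has won it; and if the game is not over and it is Red's turn,
then the move prescribed by `σ` is legal. -/
def IsWinningWithin (X : Set α) (F : Set (Set α)) (t : ℕ) (σ : Strategy α) : Prop :=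
  ∀ h : List α, IsPlay X F h → Follows σ h →
    redMoveCount h ≤ t ∧
    (IsOver X F h → RedWins F h) ∧
    (¬ IsOver X F h → RedToMove h → σ h ∈ X ∧ σ h ∉ h)

/-- Red has a strategy for winning the strong game `(X, F)` within at most `t` moves. -/
def RedHasWinningStrategyWithin (X : Set α) (F : Set (Set α)) (t : ℕ) : Prop :=
  ∃ σ : Strategy α, IsWinningWithin X F t σ

end StrongGame

open Classical in
/-- The edge sets of all spanning subgraphs of `G` with minimum degree at least `k`
(a graph `H ≤ G` on the same vertex set is a spanning subgraph of `G`). -/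
def minDegreeWinningSets {V : Type*} [Fintype V] (G : SimpleGraph V) (k : ℕ) :
    Set (Set (Sym2 V)) :=
  {A | ∃ H : SimpleGraph V, H ≤ G ∧ k ≤ H.minDegree ∧ A = H.edgeSet}

/-! ### Histories, claimed sets and strategies obtained from invariants -/

namespace StrongGame

variable {α : Type*}

/-! Red builds a matching. Let U be the set of vertices missed by Red's edges, F the graph of pairs
lost to him (non-edges of G and Blue's edges), and D the degree sum of F on U. The aim is to reach
|U| = 3 or 4 with D ≤ |U|.

Red claims uv, where u has maximum F-degree in U and v has maximum F-degree among the non-neighbours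
of u. This removes 2(deg u + deg v) from D, and Blue's reply adds at most 2. Once D ≤ |U| holds, it
persists (`greedy_step_of_sparse`). Before that, `greedy_gain` shows that the average D/|U| drops by
at least 1/(2|U'|), U' being the new U. The harmonic series diverges, so for large n the average
falls from at most m to at most 1 while U is still large.

Endgame: k edges of Blue touch at most 2k vertices, so Blue threatens only at the very end. For n
odd, three vertices remain; one more matching edge leaves a single vertex, Blue still misses some
vertex, and any free edge finishes. For n even, four vertices remain and D ≤ 4 yields two disjoint
free pairs. Red claims one of them, chosen so that if Blue takes the other, Blue's following move
cannot win either (`exists_goodMove_of_pairs`). This leaves Red time for two more moves. -/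

theorem redClaimed_append_of_even {h : List α} {k : ℕ} (hk : h.length = 2 * k) (e : α) :
    redClaimed (h ++ [e]) = insert e (redClaimed h) := by
  ext x
  simp only [redClaimed, Set.mem_ofPred_eq, Set.mem_insert_iff]
  constructor
  · rintro ⟨i, hi⟩
    rcases lt_trichotomy i k with h1 | h1 | h1
    · rw [List.getElem?_append_left (by omega)] at hi
      exact Or.inr ⟨i, hi⟩
    · subst h1
      rw [← hk, List.getElem?_concat_length] at hi
      exact Or.inl (Option.some.inj hi).symm
    · rw [List.getElem?_eq_none (by simp; omega)] at hi
      cases hi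
  · rintro (rfl | ⟨i, hi⟩)
    · exact ⟨k, by rw [← hk, List.getElem?_concat_length]⟩
    · obtain ⟨h1, -⟩ := List.getElem?_eq_some_iff.1 hi
      exact ⟨i, by rw [List.getElem?_append_left h1, hi]⟩

theorem blueClaimed_append_of_even {h : List α} {k : ℕ} (hk : h.length = 2 * k) (e : α) :
    blueClaimed (h ++ [e]) = blueClaimed h := by
  ext x
  simp only [blueClaimed, Set.mem_ofPred_eq]
  constructor
  · rintro ⟨i, hi⟩
    obtain ⟨h1, -⟩ := List.getElem?_eq_some_iff.1 hi
    simp only [List.length_append, List.length_singleton] at h1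
    rw [List.getElem?_append_left (by omega)] at hi
    exact ⟨i, hi⟩
  · rintro ⟨i, hi⟩
    obtain ⟨h1, -⟩ := List.getElem?_eq_some_iff.1 hi
    exact ⟨i, by rw [List.getElem?_append_left h1, hi]⟩

theorem redClaimed_append_of_odd {h : List α} {k : ℕ} (hk : h.length = 2 * k + 1) (e : α) :
    redClaimed (h ++ [e]) = redClaimed h := by
  ext x
  simp only [redClaimed, Set.mem_ofPred_eq]
  constructor
  · rintro ⟨i, hi⟩
    obtain ⟨h1, -⟩ := List.getElem?_eq_some_iff.1 hi
    simp only [List.length_append, List.length_singleton] at h1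
    rw [List.getElem?_append_left (by omega)] at hi
    exact ⟨i, hi⟩
  · rintro ⟨i, hi⟩
    obtain ⟨h1, -⟩ := List.getElem?_eq_some_iff.1 hi
    exact ⟨i, by rw [List.getElem?_append_left h1, hi]⟩

theorem blueClaimed_append_of_odd {h : List α} {k : ℕ} (hk : h.length = 2 * k + 1) (e : α) :
    blueClaimed (h ++ [e]) = insert e (blueClaimed h) := by
  ext x
  simp only [blueClaimed, Set.mem_ofPred_eq, Set.mem_insert_iff]
  constructor
  · rintro ⟨i, hi⟩
    rcases lt_trichotomy i k with h1 | h1 | h1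
    · rw [List.getElem?_append_left (by omega)] at hi
      exact Or.inr ⟨i, hi⟩
    · subst h1
      rw [← hk, List.getElem?_concat_length] at hi
      exact Or.inl (Option.some.inj hi).symm
    · rw [List.getElem?_eq_none (by simp; omega)] at hi
      cases hi
  · rintro (rfl | ⟨i, hi⟩)
    · exact ⟨k, by rw [← hk, List.getElem?_concat_length]⟩
    · obtain ⟨h1, -⟩ := List.getElem?_eq_some_iff.1 hi
      exact ⟨i, by rw [List.getElem?_append_left h1, hi]⟩

theorem mem_iff_mem_claimed {h : List α} {e : α} :
    e ∈ h ↔ e ∈ redClaimed h ∨ e ∈ blueClaimed h := by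
  rw [List.mem_iff_getElem?]
  constructor
  · rintro ⟨i, hi⟩
    rcases Nat.even_or_odd' i with ⟨j, rfl | rfl⟩
    · exact Or.inl ⟨j, hi⟩
    · exact Or.inr ⟨j, hi⟩
  · rintro (⟨j, hj⟩ | ⟨j, hj⟩)
    exacts [⟨_, hj⟩, ⟨_, hj⟩]

theorem Follows.of_append {σ : Strategy α} {h : List α} {e : α} (hf : Follows σ (h ++ [e])) :
    Follows σ h := by
  intro i x hx
  obtain ⟨h1, -⟩ := List.getElem?_eq_some_iff.1 hx
  rw [hf i x (by rw [List.getElem?_append_left h1, hx]), List.take_append_of_le_length h1.le]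

theorem Follows.last_eq {σ : Strategy α} {h : List α} {e : α} {k : ℕ}
    (hk : h.length = 2 * k) (hf : Follows σ (h ++ [e])) : e = σ h := by
  have := hf k e (by rw [← hk, List.getElem?_concat_length])
  rwa [← hk, List.take_left] at this

/-- The history `h` has `k` complete rounds, in which Red claimed `R` and Blue claimed `B`. -/
structure HasRounds (h : List α) (R B : Finset α) (k : ℕ) : Prop where
  length_eq : h.length = 2 * k
  red_eq : redClaimed h = R
  blue_eq : blueClaimed h = B

/-- A property of positions with Red to move which Red can preserve, and in which at most `t`
moves of Red have to be made, yields a winning strategy. -/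
theorem redHasWinningStrategyWithin_of_invariant [DecidableEq α] {X : Set α} {F : Set (Set α)}
    {t : ℕ} (P : Finset α → Finset α → ℕ → Prop) (h0 : P ∅ ∅ 0)
    (hP : ∀ R B k, P R B k → k < t ∧ ¬ Completes F (R : Set α) ∧ ¬ Completes F (B : Set α) ∧
      ∃ e ∈ X, e ∉ R ∧ e ∉ B ∧ (Completes F (insert e R : Finset α) ∨
        (¬ Completes F (insert e R : Finset α) ∧ (∃ g ∈ X, g ∉ insert e R ∧ g ∉ B) ∧
          ∀ f ∈ X, f ∉ insert e R → f ∉ B → P (insert e R) (insert f B) (k + 1)))) :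
    RedHasWinningStrategyWithin X F t := by
  classical
  have key : ∀ h : List α, ∃ e : α, ∀ R B k, HasRounds h R B k → P R B k →
      e ∈ X ∧ e ∉ R ∧ e ∉ B ∧ (Completes F (insert e R : Finset α) ∨
        (¬ Completes F (insert e R : Finset α) ∧ (∃ g ∈ X, g ∉ insert e R ∧ g ∉ B) ∧
          ∀ f ∈ X, f ∉ insert e R → f ∉ B → P (insert e R) (insert f B) (k + 1))) := by
    intro h
    by_cases hg : ∃ R B k, HasRounds h R B k ∧ P R B k
    · obtain ⟨R, B, k, hr, hp⟩ := hg
      obtain ⟨-, -, -, e, he⟩ := hP R B k hp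
      -- The history determines `R`, `B` and `k`, so one choice of `e` serves all of them.
      refine ⟨e, fun R' B' k' hr' _ => ?_⟩
      obtain rfl : R' = R := Finset.coe_injective (hr'.red_eq.symm.trans hr.red_eq)
      obtain rfl : B' = B := Finset.coe_injective (hr'.blue_eq.symm.trans hr.blue_eq)
      obtain rfl : k' = k := by have := hr'.length_eq; have := hr.length_eq; omega
      exact he
    · obtain ⟨-, -, -, e, -⟩ := hP _ _ _ h0
      exact ⟨e, fun R B k hr hp => (hg ⟨R, B, k, hr, hp⟩).elim⟩
  choose σ hσ using key
  have inv : ∀ h, IsPlay X F h → Follows σ h →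
      (∃ R B k, HasRounds h R B k ∧ P R B k) ∨
      (∃ h' R B k, h = h' ++ [σ h'] ∧ HasRounds h' R B k ∧ P R B k) := by
    intro h hp
    induction hp with
    | nil =>
      intro _
      exact Or.inl ⟨∅, ∅, 0, ⟨rfl, by ext; simp [redClaimed], by ext; simp [blueClaimed]⟩, h0⟩
    | @move h e hplay hover hX hfree ih =>
      intro hf
      rcases ih hf.of_append with ⟨R, B, k, hr, hp⟩ | ⟨h', R, B, k, rfl, hr, hp⟩
      · refine Or.inr ⟨h, R, B, k, ?_, hr, hp⟩
        rw [← hf.last_eq hr.length_eq]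
      · left
        have hl : (h' ++ [σ h']).length = 2 * k + 1 := by simp [hr.length_eq]
        have hred : redClaimed (h' ++ [σ h']) = (insert (σ h') R : Finset α) := by
          rw [redClaimed_append_of_even hr.length_eq, hr.red_eq, Finset.coe_insert]
        have hblue : blueClaimed (h' ++ [σ h']) = B := by
          rw [blueClaimed_append_of_even hr.length_eq, hr.blue_eq]
        obtain ⟨-, -, -, hc | ⟨-, -, hc⟩⟩ := hσ h' R B k hr hp
        · exact (hover (Or.inl (by rwa [hred]))).elim
        · rw [mem_iff_mem_claimed, hred, hblue, not_or, Finset.mem_coe, Finset.mem_coe] at hfree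
          refine ⟨_, _, _, ⟨?_, ?_, ?_⟩, hc e hX hfree.1 hfree.2⟩
          · simp [hr.length_eq]; ring
          · rw [redClaimed_append_of_odd hl, hred]
          · rw [blueClaimed_append_of_odd hl, hblue, Finset.coe_insert]
  refine ⟨σ, fun h hp hf => ?_⟩
  rcases inv h hp hf with ⟨R, B, k, hr, hp⟩ | ⟨h', R, B, k, rfl, hr, hp⟩
  · obtain ⟨hk, hnr, hnb, -⟩ := hP R B k hp
    obtain ⟨he, heR, heB, -⟩ := hσ h R B k hr hp
    have hmem : σ h ∉ h := by
      rw [mem_iff_mem_claimed, hr.red_eq, hr.blue_eq]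
      simp [heR, heB]
    refine ⟨by rw [redMoveCount, hr.length_eq]; omega, fun ho => ?_, fun _ _ => ⟨he, hmem⟩⟩
    rcases ho with ho | ho | ho
    · exact (hnr (hr.red_eq ▸ ho)).elim
    · exact (hnb (hr.blue_eq ▸ ho)).elim
    · exact (hmem (ho _ he)).elim
  · obtain ⟨hk, -, hnb, -⟩ := hP R B k hp
    obtain ⟨-, -, -, hc⟩ := hσ h' R B k hr hp
    have hred : redClaimed (h' ++ [σ h']) = (insert (σ h') R : Finset α) := by
      rw [redClaimed_append_of_even hr.length_eq, hr.red_eq, Finset.coe_insert]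
    have hblue : blueClaimed (h' ++ [σ h']) = B := by
      rw [blueClaimed_append_of_even hr.length_eq, hr.blue_eq]
    refine ⟨by simp only [redMoveCount, List.length_append, hr.length_eq, List.length_singleton]
               omega, fun ho => ?_, fun _ hm => ?_⟩
    · refine ⟨?_, by rwa [hblue]⟩
      rcases hc with hc | ⟨hc, ⟨g, hg, hgR, hgB⟩, -⟩
      · rwa [hred]
      · rcases ho with ho | ho | ho
        · exact ho
        · exact (hnb (hblue ▸ ho)).elim
        · have := ho g hg
          rw [mem_iff_mem_claimed, hred, hblue] at this
          exact (this.elim (fun h => hgR (Finset.mem_coe.1 h)) hgB).elim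
    · simp only [RedToMove, List.length_append, hr.length_eq, List.length_singleton] at hm
      exact absurd hm (by simp)

end StrongGame

/-! ### Degree sums and the greedy pair -/

namespace SimpleGraph

variable {V : Type*}

open Classical in
/-- The number of neighbours of `v` in `U`. -/
noncomputable def degIn (F : SimpleGraph V) (U : Finset V) (v : V) : ℕ :=
  (U.filter fun w => F.Adj v w).card

/-- The sum of the degrees of the graph induced on `U`. -/
noncomputable def degSum (F : SimpleGraph V) (U : Finset V) : ℕ :=
  ∑ v ∈ U, F.degIn U v

theorem degIn_mono (F : SimpleGraph V) {U U' : Finset V} (h : U' ⊆ U) (v : V) :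
    F.degIn U' v ≤ F.degIn U v := by
  classical
  exact Finset.card_le_card (Finset.filter_subset_filter _ h)

theorem degIn_erase_of_not_adj [DecidableEq V] (F : SimpleGraph V) (U : Finset V) {u v : V}
    (h : ¬ F.Adj v u) : F.degIn (U.erase u) v = F.degIn U v := by
  classical
  unfold degIn
  congr 1
  ext w
  simp only [Finset.mem_filter, Finset.mem_erase]
  constructor
  · rintro ⟨⟨-, h1⟩, h2⟩
    exact ⟨h1, h2⟩
  · rintro ⟨h1, h2⟩
    exact ⟨⟨fun hw => h (hw ▸ h2), h1⟩, h2⟩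

/-- Each edge at `u` is counted once at `u` and once at its other end. -/
theorem degSum_erase [DecidableEq V] (F : SimpleGraph V) {U : Finset V} {u : V} (hu : u ∈ U) :
    F.degSum (U.erase u) + 2 * F.degIn U u = F.degSum U := by
  classical
  have h1 : ∀ w, F.degIn U w = F.degIn (U.erase u) w + if F.Adj u w then 1 else 0 := by
    intro w
    split_ifs with h
    · unfold degIn
      have : u ∈ U.filter fun x => F.Adj w x := by simp [hu, h.symm]
      rw [← Finset.card_erase_add_one this, Finset.filter_erase]
    · rw [degIn_erase_of_not_adj F U fun h' => h h'.symm, add_zero]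
  have h2 : ∑ w ∈ U.erase u, (if F.Adj u w then 1 else 0) = F.degIn U u := by
    rw [← degIn_erase_of_not_adj F U (F.loopless.irrefl u), degIn, Finset.card_filter]
  have h3 : F.degSum U = ∑ w ∈ U.erase u, F.degIn U w + F.degIn U u :=
    (Finset.sum_erase_add U _ hu).symm
  rw [h3, Finset.sum_congr rfl fun w _ => h1 w, Finset.sum_add_distrib, h2, degSum]
  ring

theorem two_mul_degIn_le_degSum (F : SimpleGraph V) {U : Finset V} {u : V} (hu : u ∈ U) :
    2 * F.degIn U u ≤ F.degSum U := by
  classical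
  have := F.degSum_erase hu
  omega

theorem degSum_erase_erase [DecidableEq V] (F : SimpleGraph V) {U : Finset V} {u v : V}
    (hu : u ∈ U) (hv : v ∈ U) (huv : u ≠ v) (h : ¬ F.Adj u v) :
    F.degSum ((U.erase u).erase v) + 2 * (F.degIn U u + F.degIn U v) = F.degSum U := by
  have h1 := F.degSum_erase hu
  have h2 := F.degSum_erase (Finset.mem_erase.2 ⟨huv.symm, hv⟩)
  rw [degIn_erase_of_not_adj F U fun h' => h h'.symm] at h2
  omega

/-- A vertex of maximum degree in `U` and a vertex of maximum degree among its non-neighbours. -/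
theorem exists_greedy_pair (F : SimpleGraph V) {U : Finset V} (hU : U.Nonempty)
    (hdeg : ∀ w ∈ U, F.degIn U w + 2 ≤ U.card) :
    ∃ u ∈ U, ∃ v ∈ U, u ≠ v ∧ ¬ F.Adj u v ∧ (∀ w ∈ U, F.degIn U w ≤ F.degIn U u) ∧
      F.degSum U ≤ U.card * F.degIn U v + F.degIn U u * (F.degIn U u + 1) := by
  classical
  obtain ⟨u, hu, hmax⟩ := U.exists_max_image (F.degIn U) hU
  set A := insert u (U.filter fun w => F.Adj u w) with hA
  have hAU : A ⊆ U := by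
    intro w hw
    rcases Finset.mem_insert.1 hw with rfl | hw
    exacts [hu, (Finset.mem_filter.1 hw).1]
  have hAc : A.card = F.degIn U u + 1 := Finset.card_insert_of_notMem (by simp)
  have hne : (U \ A).Nonempty := by
    rw [← Finset.card_pos, Finset.card_sdiff_of_subset hAU, hAc]
    have := hdeg u hu
    omega
  obtain ⟨v, hv, hvmax⟩ := (U \ A).exists_max_image (F.degIn U) hne
  have hv' := Finset.mem_sdiff.1 hv
  refine ⟨u, hu, v, hv'.1, ?_, ?_, hmax, ?_⟩
  · rintro rfl
    exact hv'.2 (Finset.mem_insert_self _ _)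
  · intro h
    exact hv'.2 (Finset.mem_insert_of_mem (Finset.mem_filter.2 ⟨hv'.1, h⟩))
  -- Outside the closed neighbourhood `A` of `u`, degrees are at most that of `v`; inside it, `deg u
  -- + 1` vertices have degree at most `deg u`.
  · rw [degSum, ← Finset.sum_sdiff hAU]
    gcongr
    · calc _ ≤ (U \ A).card * F.degIn U v := by
            simpa using Finset.sum_le_card_nsmul _ _ _ hvmax
        _ ≤ _ := Nat.mul_le_mul_right _ (Finset.card_le_card Finset.sdiff_subset)
    · calc _ ≤ A.card * F.degIn U u := by
            simpa using Finset.sum_le_card_nsmul A _ _ fun w hw => hmax w (hAU hw)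
        _ = _ := by rw [hAc, mul_comm]

/-! ### Making the bad graph sparse, and keeping it so -/

/-- The harmonic numbers. -/
noncomputable def harmonicSum (n : ℕ) : ℝ := ∑ i ∈ Finset.range n, 1 / ((i : ℝ) + 1)

theorem harmonicSum_mono : Monotone harmonicSum := by
  intro a b hab
  exact Finset.sum_le_sum_of_subset_of_nonneg (Finset.range_mono hab) fun _ _ _ => by positivity

theorem mul_harmonicSum_sub_le (n : ℕ) : (n : ℝ) * (harmonicSum (n + 2) - harmonicSum n) ≤ 2 := by
  have h : harmonicSum (n + 2) - harmonicSum n = 1 / ((n : ℝ) + 1) + 1 / ((n : ℝ) + 1 + 1) := by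
    simp [harmonicSum, Finset.sum_range_succ]
    ring
  have h1 : (n : ℝ) * (1 / ((n : ℝ) + 1)) ≤ 1 := by
    rw [mul_one_div, div_le_one (by positivity)]; linarith
  have h2 : (n : ℝ) * (1 / ((n : ℝ) + 1 + 1)) ≤ 1 := by
    rw [mul_one_div, div_le_one (by positivity)]; linarith
  rw [h, mul_add]
  linarith

/-- The invariant of the greedy strategy: `F` is sparse on `U`, or it is at least moderately sparse
and `U` is still large enough for the greedy strategy to make it sparse in time. -/
def GreedyInvariant (m K : ℕ) (F : SimpleGraph V) (U : Finset V) : Prop :=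
  F.degSum U ≤ U.card ∨
    (K ≤ U.card ∧ F.degSum U ≤ m * U.card ∧
      (F.degSum U : ℝ) ≤ U.card * (1 + (harmonicSum U.card - harmonicSum K) / 4) ∧
      ∀ w ∈ U, (F.degIn U w : ℝ) ≤ U.card / 12 + 14 * (m + 1 - F.degSum U / U.card))

/-- The 4 pays for Blue's reply (2) and for the two vertices leaving `U`. It is immediate unless
`deg u + deg v ≤ 1`; then the degree sum is at most 2. -/
theorem greedy_step_of_sparse {F : SimpleGraph V} {U : Finset V} (hU : 4 ≤ U.card)
    (h : F.degSum U ≤ U.card) :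
    ∃ u ∈ U, ∃ v ∈ U, u ≠ v ∧ ¬ F.Adj u v ∧
      F.degSum U + 4 ≤ U.card + 2 * (F.degIn U u + F.degIn U v) := by
  obtain ⟨u, hu, v, hv, huv, hadj, hmax, hsum⟩ := F.exists_greedy_pair (U := U)
    (Finset.card_pos.1 (by omega)) fun w hw => by
      have := F.two_mul_degIn_le_degSum hw
      omega
  refine ⟨u, hu, v, hv, huv, hadj, ?_⟩
  have hvu := hmax v hv
  generalize F.degIn U u = a at *
  generalize F.degIn U v = b at *
  rcases Nat.lt_or_ge a 2 with ha | ha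
  · interval_cases a
    · obtain rfl : b = 0 := by omega
      simp at hsum
      omega
    · rcases Nat.eq_zero_or_pos b with rfl | hb
      · simp at hsum
        omega
      · omega
  · omega

/-- The gain in a greedy step, where `N` is the number of vertices, `D` the degree sum and `a`, `b`
the two degrees. -/
theorem greedy_gain {m N D a b : ℕ} (hN : 400 * (m + 2) ^ 2 ≤ N) (hD : N < D) (hDm : D ≤ m * N)
    (ha : D ≤ N * a) (hab : D ≤ N * b + a * (a + 1)) :
    (D : ℝ) / N + 5 / 4 ≤ a + b := by
  have hN0 : (0 : ℝ) < N := by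
    have : 0 < N := by nlinarith
    exact_mod_cast this
  set x : ℝ := D / N with hx
  have hDx : (D : ℝ) = x * N := by rw [hx]; field_simp
  have hx1 : 1 < x := by rw [hx, one_lt_div hN0]; exact_mod_cast hD
  have hxm : x ≤ m := by rw [hx, div_le_iff₀ hN0]; exact_mod_cast hDm
  have hxa : x ≤ a := by rw [hx, div_le_iff₀' hN0]; exact_mod_cast ha
  -- If `a ≥ m + 2`, then `a` alone suffices. Otherwise the term `a * (a + 1)` is negligible against
  -- `N`, so `b ≥ x - 1/8`; integrality then gives `a ≥ 2` and `b ≥ 1`, which settles `x` near 1.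
  rcases Nat.lt_or_ge a (m + 2) with ham | ham
  · have h1 : a * (a + 1) ≤ (m + 1) * (m + 2) := Nat.mul_le_mul (by omega) (by omega)
    have h2 : x - 1 / 8 ≤ b := by
      have h3 : (D : ℝ) ≤ N * b + (m + 1) * (m + 2) := by
        exact_mod_cast hab.trans (Nat.add_le_add_left h1 _)
      have h4 : (400 : ℝ) * (m + 2) ^ 2 ≤ N := by exact_mod_cast hN
      have h5 : (0 : ℝ) ≤ m := by positivity
      have h6 : (x - 1 / 8) * N ≤ b * N := by nlinarith
      exact le_of_mul_le_mul_right h6 hN0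
    have h7 : 1 ≤ b := by
      by_contra hb
      obtain rfl : b = 0 := by omega
      norm_num at h2
      linarith
    have h8 : 2 ≤ a := by
      by_contra hb
      have : (a : ℝ) ≤ 1 := by exact_mod_cast (by omega : a ≤ 1)
      linarith
    have h9 : (3 : ℝ) ≤ a + b := by exact_mod_cast (by omega : 3 ≤ a + b)
    rcases le_total x (3 / 2) with hx2 | hx2 <;> linarith
  · have : (m : ℝ) + 2 ≤ a := by exact_mod_cast ham
    have : (0 : ℝ) ≤ b := by positivity
    linarith

/-- The hypotheses on `F'` are exactly what one Blue edge can do. The degree bound in the invariant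
serves to guarantee that `u` has a non-neighbour. -/
theorem GreedyInvariant.step [DecidableEq V] {m K : ℕ} (hK : 400 * (m + 2) ^ 2 ≤ K)
    {F : SimpleGraph V} {U : Finset V} (hU : 5 ≤ U.card) (h : GreedyInvariant m K F U) :
    ∃ u ∈ U, ∃ v ∈ U, u ≠ v ∧ ¬ F.Adj u v ∧ ∀ F' : SimpleGraph V,
      F'.degSum ((U.erase u).erase v) ≤ F.degSum ((U.erase u).erase v) + 2 →
      (∀ w, F'.degIn ((U.erase u).erase v) w ≤ F.degIn ((U.erase u).erase v) w + 1) →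
      GreedyInvariant m K F' ((U.erase u).erase v) := by
  have hcard : ∀ {u v : V}, u ∈ U → v ∈ U → u ≠ v →
      ((U.erase u).erase v).card + 2 = U.card := by
    intro u v hu hv huv
    rw [Finset.card_erase_of_mem (Finset.mem_erase.2 ⟨huv.symm, hv⟩), Finset.card_erase_of_mem hu]
    omega
  rcases Nat.lt_or_ge U.card (F.degSum U) with hlt | hge
  · obtain ⟨hKN, hDm, hDh, hdeg⟩ := h.resolve_left hlt.not_ge
    have hN : 400 * (m + 2) ^ 2 ≤ U.card := hK.trans hKN
    have hNr : (400 : ℝ) * (m + 2) ^ 2 ≤ U.card := by exact_mod_cast hN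
    have hm0 : (0 : ℝ) ≤ m := by positivity
    have hN1 : (400 : ℝ) * (m + 2) ≤ U.card := by nlinarith
    have hN0 : (0 : ℝ) < U.card := by linarith
    obtain ⟨u, hu, v, hv, huv, hadj, hmax, hsum⟩ := F.exists_greedy_pair (U := U)
      (Finset.card_pos.1 (by omega)) fun w hw => by
        have h1 := hdeg w hw
        have h2 : (0 : ℝ) ≤ (F.degSum U : ℝ) / U.card := by positivity
        have h3 : (F.degIn U w : ℝ) + 2 ≤ U.card := by linarith
        exact_mod_cast h3
    refine ⟨u, hu, v, hv, huv, hadj, fun F' hF' hd' => ?_⟩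
    have hDa : F.degSum U ≤ U.card * F.degIn U u := by
      have := Finset.sum_le_card_nsmul U _ _ hmax
      rwa [smul_eq_mul] at this
    have hgain := greedy_gain hN hlt hDm hDa hsum
    have hrem := F.degSum_erase_erase hu hv huv hadj
    have hc := hcard hu hv huv
    have hdu := hdeg u hu
    have hd : ∀ w ∈ (U.erase u).erase v, F'.degIn ((U.erase u).erase v) w ≤ F.degIn U u + 1 := by
      intro w hw
      have hwU : w ∈ U := Finset.mem_of_mem_erase (Finset.mem_of_mem_erase hw)
      have h1 := F.degIn_mono (U := U) (U' := (U.erase u).erase v)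
        ((Finset.erase_subset _ _).trans (Finset.erase_subset _ _)) w
      have h2 := hmax w hwU
      have h3 := hd' w
      omega
    generalize (U.erase u).erase v = U' at *
    have hD' : F'.degSum U' + 2 * (F.degIn U u + F.degIn U v) ≤ F.degSum U + 2 := by omega
    have hDr : (F'.degSum U' : ℝ) + 2 * (F.degIn U u + F.degIn U v) ≤ F.degSum U + 2 := by
      exact_mod_cast hD'
    have hcr : (U'.card : ℝ) + 2 = U.card := by exact_mod_cast hc
    have hN'0 : (0 : ℝ) < U'.card := by linarith
    have hharm := mul_harmonicSum_sub_le U'.card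
    rw [hc] at hharm
    set x : ℝ := F.degSum U / U.card with hx
    have hDx : (F.degSum U : ℝ) = x * U.card := by rw [hx]; field_simp
    have hxm : x ≤ m := by rw [hx, div_le_iff₀ hN0]; exact_mod_cast hDm
    have hx0 : 0 ≤ x := div_nonneg (Nat.cast_nonneg _) hN0.le
    have hxh : x ≤ 1 + (harmonicSum U.card - harmonicSum K) / 4 := by
      rw [hx, div_le_iff₀ hN0]; linarith
    -- The excess 5/4 in the gain, doubled, beats Blue's 2 by 1/2; this matches the change in the
    -- harmonic term, at most 2/4.
    have hD'x : (F'.degSum U' : ℝ) ≤ x * U'.card - 1 / 2 := by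
      rw [hDx, ← hcr] at hDr
      linarith
    have hD'h : (F'.degSum U' : ℝ) ≤
        U'.card * (1 + (harmonicSum U'.card - harmonicSum K) / 4) := by
      have := mul_le_mul_of_nonneg_right hxh hN'0.le
      linarith
    -- Below `K` the harmonic correction is nonpositive, so the average is at most 1.
    rcases Nat.lt_or_ge U'.card K with hlt' | hge'
    · left
      have h1 := harmonicSum_mono hlt'.le
      have h2 : (F'.degSum U' : ℝ) ≤ U'.card := by nlinarith
      exact_mod_cast h2
    · right
      have hD'm : (F'.degSum U' : ℝ) ≤ m * U'.card := by
        have := mul_le_mul_of_nonneg_right hxm hN'0.le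
        linarith
      refine ⟨hge', by exact_mod_cast hD'm, hD'h, fun w hw => ?_⟩
      have hw' : (F'.degIn U' w : ℝ) ≤ F.degIn U u + 1 := by exact_mod_cast hd w hw
      -- A maximum degree below `|U|/12` leaves ample slack. Otherwise deleting `u` lowers the
      -- average by 1/12, and 14/12 pays for Blue's increment 1 and the loss 2/12 in `|U|/12`.
      rcases le_total (F.degIn U u : ℝ) (U.card / 12) with hle | hle
      · have : (F'.degSum U' : ℝ) / U'.card ≤ m := by rwa [div_le_iff₀ hN'0]
        linarith
      · have h1 : (F'.degSum U' : ℝ) / U'.card ≤ x - 1 / 12 := by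
          rw [div_le_iff₀ hN'0]
          have : (0 : ℝ) ≤ F.degIn U v := by positivity
          rw [hDx, ← hcr] at hDr
          linarith
        linarith
  · obtain ⟨u, hu, v, hv, huv, hadj, hdrop⟩ := greedy_step_of_sparse (by omega) hge
    refine ⟨u, hu, v, hv, huv, hadj, fun F' hF' _ => Or.inl ?_⟩
    have hrem := F.degSum_erase_erase hu hv huv hadj
    have hc := hcard hu hv huv
    omega

theorem exists_greedyInvariant_univ (m K : ℕ) (hK : 400 * (m + 2) ^ 2 ≤ K) :
    ∃ n₀, ∀ (V : Type*) [Fintype V] (F : SimpleGraph V), n₀ ≤ Fintype.card V →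
      (∀ v, F.degIn Finset.univ v ≤ m) → GreedyInvariant m K F Finset.univ := by
  obtain ⟨n₁, hn₁⟩ := Filter.eventually_atTop.1
    (Real.tendsto_sum_range_one_div_nat_succ_atTop.eventually_ge_atTop (harmonicSum K + 4 * m))
  refine ⟨max n₁ K, fun V _ F hV hF => Or.inr ?_⟩
  rw [Finset.card_univ]
  have hKV : K ≤ Fintype.card V := (le_max_right _ _).trans hV
  have hh : harmonicSum K + 4 * m ≤ harmonicSum (Fintype.card V) :=
    hn₁ _ ((le_max_left _ _).trans hV)
  have hD : F.degSum Finset.univ ≤ m * Fintype.card V := by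
    have := Finset.sum_le_card_nsmul Finset.univ _ _ fun v _ => hF v
    simpa [degSum, mul_comm] using this
  have hDr : (F.degSum Finset.univ : ℝ) ≤ m * Fintype.card V := by exact_mod_cast hD
  have hn : (0 : ℝ) < Fintype.card V := by
    have : 0 < Fintype.card V := by nlinarith
    exact_mod_cast this
  refine ⟨hKV, hD, ?_, fun w _ => ?_⟩
  · nlinarith
  · have h1 : (F.degSum Finset.univ : ℝ) / Fintype.card V ≤ m := by rwa [div_le_iff₀ hn]
    have h2 : (F.degIn Finset.univ w : ℝ) ≤ m := by exact_mod_cast hF w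
    have h3 : (400 : ℝ) * (m + 2) ^ 2 ≤ Fintype.card V := by exact_mod_cast hK.trans hKV
    have h4 : (0 : ℝ) ≤ m := by positivity
    nlinarith

end SimpleGraph

/-! ### Blue's effect on the bad graph -/

namespace MinDegreeGame

open SimpleGraph StrongGame

variable {V : Type*} [DecidableEq V]

/-- The vertices incident with an edge of `S`. -/
def touched (S : Finset (Sym2 V)) : Finset V := S.biUnion Sym2.toFinset

theorem mem_touched {S : Finset (Sym2 V)} {v : V} : v ∈ touched S ↔ ∃ e ∈ S, v ∈ e := by
  simp [touched]

theorem touched_insert (e : Sym2 V) (S : Finset (Sym2 V)) :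
    touched (insert e S) = e.toFinset ∪ touched S :=
  Finset.biUnion_insert

theorem card_toFinset_le_two (e : Sym2 V) : e.toFinset.card ≤ 2 := by
  induction e with
  | _ x y => rw [Sym2.toFinset_mk_eq]; exact Finset.card_le_two

theorem card_touched_le (S : Finset (Sym2 V)) : (touched S).card ≤ 2 * S.card := by
  rw [mul_comm]
  exact Finset.card_biUnion_le_card_mul _ _ _ fun e _ => card_toFinset_le_two e

theorem mk_notMem_of_notMem_touched {S : Finset (Sym2 V)} {v : V} (hv : v ∉ touched S) (w : V) :
    s(v, w) ∉ S :=
  fun h => hv (mem_touched.2 ⟨_, h, Sym2.mem_mk_left v w⟩)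

/-- The pairs of vertices whose edge Red can no longer claim, where `B` has been claimed by Blue. -/
def badGraph (G : SimpleGraph V) (B : Finset (Sym2 V)) : SimpleGraph V where
  Adj u v := u ≠ v ∧ (¬ G.Adj u v ∨ s(u, v) ∈ B)
  symm := ⟨fun u v h => ⟨h.1.symm, by rw [G.adj_comm, Sym2.eq_swap]; exact h.2⟩⟩
  loopless := ⟨fun _ h => h.1 rfl⟩

theorem not_badGraph_adj {G : SimpleGraph V} {B : Finset (Sym2 V)} {u v : V} (huv : u ≠ v) :
    ¬ (badGraph G B).Adj u v ↔ G.Adj u v ∧ s(u, v) ∉ B := by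
  simp only [badGraph]
  tauto

theorem degIn_badGraph_insert_le (G : SimpleGraph V) (B : Finset (Sym2 V)) (U : Finset V)
    {x y : V} (hxy : x ≠ y) (w : V) :
    (badGraph G (insert s(x, y) B)).degIn U w ≤
      (badGraph G B).degIn U w + if w ∈ ({x, y} : Finset V) then 1 else 0 := by
  classical
  have h : ∀ T : Finset V, (∀ z, s(w, z) = s(x, y) → z ∈ T) →
      (badGraph G (insert s(x, y) B)).degIn U w ≤ (badGraph G B).degIn U w + T.card := by
    intro T hT
    refine (Finset.card_le_card fun z hz => ?_).trans (Finset.card_union_le _ _)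
    obtain ⟨hzU, hne, hz⟩ := Finset.mem_filter.1 hz
    rw [Finset.mem_insert] at hz
    by_cases h' : s(w, z) = s(x, y)
    · exact Finset.mem_union_right _ (hT z h')
    · refine Finset.mem_union_left _ (Finset.mem_filter.2 ⟨hzU, hne, ?_⟩)
      tauto
  split_ifs with hw
  · rcases Finset.mem_insert.1 hw with rfl | hw
    · simpa using h {y} fun z hz => Finset.mem_singleton.2 (Sym2.congr_right.1 hz)
    · rw [Finset.mem_singleton] at hw
      subst hw
      simpa using h {x} fun z hz => by
        rw [Sym2.eq_swap, Sym2.congr_left] at hz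
        simpa using hz
  · simpa using h ∅ fun z hz => by
      have : w ∈ s(x, y) := hz ▸ Sym2.mem_mk_left w z
      simp at this hw
      tauto

theorem degSum_badGraph_insert_le (G : SimpleGraph V) (B : Finset (Sym2 V)) (U : Finset V)
    {x y : V} (hxy : x ≠ y) :
    (badGraph G (insert s(x, y) B)).degSum U ≤ (badGraph G B).degSum U + 2 := by
  refine (Finset.sum_le_sum fun w _ => degIn_badGraph_insert_le G B U hxy w).trans ?_
  rw [Finset.sum_add_distrib, degSum, ← Finset.card_filter]
  gcongr
  exact (Finset.card_le_card fun w hw => (Finset.mem_filter.1 hw).2).trans Finset.card_le_two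

/-- No edge at `v` is Red's, and Blue has too few edges to own them all. -/
theorem exists_unclaimed_edge [Fintype V] (G : SimpleGraph V) [DecidableRel G.Adj]
    {R B : Finset (Sym2 V)} {v : V} (hv : v ∉ touched R) (hB : B.card < G.degree v) :
    ∃ w, G.Adj v w ∧ s(v, w) ∉ R ∧ s(v, w) ∉ B := by
  by_contra! hcon
  refine hB.not_ge ?_
  rw [← G.card_neighborFinset_eq_degree]
  refine Finset.card_le_card_of_injOn (fun w => s(v, w)) (fun w hw => ?_) fun x _ y _ h => ?_
  · exact hcon w ((G.mem_neighborFinset v w).1 hw) (mk_notMem_of_notMem_touched hv w)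
  · exact Sym2.congr_right.1 h

/-! ### Good positions and the endgame -/

variable [Fintype V]

theorem completes_iff_touched_eq_univ [Nonempty V] (G : SimpleGraph V) {S : Finset (Sym2 V)}
    (hS : (S : Set (Sym2 V)) ⊆ G.edgeSet) :
    Completes (minDegreeWinningSets G 1) (S : Set (Sym2 V)) ↔ touched S = Finset.univ := by
  classical
  constructor
  · rintro ⟨A, ⟨H, -, hdeg, rfl⟩, hA⟩
    refine Finset.eq_univ_iff_forall.2 fun v => ?_
    have h1 := hdeg.trans (H.minDegree_le_degree v)
    obtain ⟨w, hw⟩ := (H.degree_pos_iff_exists_adj v).1 h1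
    exact mem_touched.2 ⟨s(v, w), hA hw, Sym2.mem_mk_left v w⟩
  · intro h
    refine ⟨_, ⟨fromEdgeSet (S : Set (Sym2 V)), ?_, ?_, rfl⟩, ?_⟩
    · intro u v huv
      exact hS ((fromEdgeSet_adj _).1 huv).1
    · refine @le_minDegree_of_forall_le_degree V _ _ (_) _ _ fun v => ?_
      obtain ⟨e, he, hv⟩ := mem_touched.1 (h ▸ Finset.mem_univ v)
      obtain ⟨w, rfl⟩ := hv
      exact (@degree_pos_iff_exists_adj V _ v (_)).2
        ⟨w, (fromEdgeSet_adj _).2 ⟨he, (show G.Adj v w from hS he).ne⟩⟩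
    · rw [edgeSet_fromEdgeSet]
      exact Set.sdiff_subset

/-- The positions with Red to move, after `k` rounds, that occur in Red's strategy. -/
def GoodPosition (G : SimpleGraph V) (m K : ℕ) (R B : Finset (Sym2 V)) (k : ℕ) : Prop :=
  ((touched R)ᶜ.card + 2 * k = Fintype.card V ∧ 3 ≤ (touched R)ᶜ.card ∧
    GreedyInvariant m K (badGraph G B) (touched R)ᶜ) ∨
  ((touched R)ᶜ.card = 1 ∧ k ≤ Fintype.card V / 2 ∧ touched B ≠ Finset.univ) ∨
  (k + 1 ≤ Fintype.card V / 2 ∧ ∃ c d, (touched R)ᶜ = {c, d} ∧ G.Adj c d ∧ s(c, d) ∉ B) ∨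
  ((touched R)ᶜ.card = 2 ∧ k + 1 ≤ Fintype.card V / 2 ∧
    ∀ f ∈ G.edgeSet, f ∉ R → touched (insert f B) ≠ Finset.univ)

theorem compl_touched_insert (R : Finset (Sym2 V)) (u v : V) :
    (touched (insert s(u, v) R))ᶜ = ((touched R)ᶜ.erase u).erase v := by
  ext w
  simp only [touched_insert, Sym2.toFinset_mk_eq, Finset.mem_compl, Finset.mem_union,
    Finset.mem_insert, Finset.mem_singleton, Finset.mem_erase]
  tauto

/-- Red claims `s(u, v)` and either wins or reaches a good position. -/
def IsGoodMove (G : SimpleGraph V) (m K : ℕ) (R B : Finset (Sym2 V)) (k : ℕ) (u v : V) : Prop :=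
  G.Adj u v ∧ s(u, v) ∉ R ∧ s(u, v) ∉ B ∧ (touched (insert s(u, v) R) = Finset.univ ∨
    ∀ f ∈ G.edgeSet, f ∉ insert s(u, v) R → f ∉ B →
      GoodPosition G m K (insert s(u, v) R) (insert f B) (k + 1))

theorem touched_ne_univ_of_two_mul_lt {B : Finset (Sym2 V)} {k : ℕ} (hB : B.card ≤ k)
    (hk : 2 * k < Fintype.card V) : touched B ≠ Finset.univ := by
  intro h
  have := card_touched_le B
  rw [h, Finset.card_univ] at this
  omega

/-- If Blue leaves `s(c, d)` free, Red wins with it. The last hypothesis ensures that taking it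
leaves Blue unable to win on the next move. -/
theorem exists_goodMove_of_pairs {G : SimpleGraph V} {m K : ℕ} {R B : Finset (Sym2 V)} {k : ℕ}
    (hB : B.card ≤ k) (hk : 2 * k + 4 = Fintype.card V) {a b c d : V}
    (hU : (touched R)ᶜ = {a, b, c, d}) (hab : G.Adj a b) (habB : s(a, b) ∉ B) (hcd : G.Adj c d)
    (hcdB : s(c, d) ∉ B) (hac : a ≠ c) (had : a ≠ d) (hbc : b ≠ c) (hbd : b ≠ d)
    (h : c ∈ touched B ∨ a ∉ touched B ∧ b ∉ touched B) : IsGoodMove G m K R B k a b := by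
  have haR : a ∉ touched R := by
    rw [← Finset.mem_compl, hU]
    simp
  have hU' : (touched (insert s(a, b) R))ᶜ = {c, d} := by
    rw [compl_touched_insert, hU]
    ext w
    have := hab.ne
    simp only [Finset.mem_erase, Finset.mem_insert, Finset.mem_singleton]
    constructor
    · tauto
    · rintro (rfl | rfl)
      · exact ⟨hbc.symm, hac.symm, by simp⟩
      · exact ⟨hbd.symm, had.symm, by simp⟩
  refine ⟨hab, mk_notMem_of_notMem_touched haR b, habB, Or.inr fun f hf hfR hfB => ?_⟩
  by_cases hfcd : f = s(c, d)
  · subst hfcd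
    refine Or.inr (Or.inr (Or.inr ⟨by rw [hU', Finset.card_pair hcd.ne], by omega, ?_⟩))
    intro e _ heR hcov
    rcases h with hc | ⟨ha, hb⟩
    · have h1 : touched (insert e (insert s(c, d) B)) ⊆ e.toFinset ∪ insert d (touched B) := by
        rw [touched_insert, touched_insert, Sym2.toFinset_mk_eq]
        intro w
        simp only [Finset.mem_union, Finset.mem_insert, Finset.mem_singleton]
        rintro (hw | (rfl | hw) | hw) <;> tauto
      have h2 := Finset.card_le_card h1
      rw [hcov, Finset.card_univ] at h2
      have h3 := Finset.card_union_le e.toFinset (insert d (touched B))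
      have h4 := Finset.card_insert_le d (touched B)
      have h5 := card_toFinset_le_two e
      have h6 := card_touched_le B
      omega
    -- Blue's completing edge would have to contain both `a` and `b`, but that edge is Red's.
    · have key : ∀ w, w ∉ touched B → w ≠ c → w ≠ d → w ∈ e := by
        intro w hw hwc hwd
        have := Finset.mem_univ w
        rw [← hcov, touched_insert, touched_insert, Sym2.toFinset_mk_eq] at this
        simpa [hw, hwc, hwd] using this
      have : e = s(a, b) :=
        (Sym2.mem_and_mem_iff hab.ne).1 ⟨key a ha hac had, key b hb hbc hbd⟩
      exact heR (this ▸ Finset.mem_insert_self _ _)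
  · refine Or.inr (Or.inr (Or.inl ⟨by omega, c, d, hU', hcd, ?_⟩))
    rw [Finset.mem_insert, not_or]
    exact ⟨fun h => hfcd h.symm, hcdB⟩

theorem GreedyInvariant.exists_goodMove {G : SimpleGraph V} {m K : ℕ}
    (hK : 400 * (m + 2) ^ 2 ≤ K) {R B : Finset (Sym2 V)} {k : ℕ} (hB : B.card ≤ k)
    (hk : (touched R)ᶜ.card + 2 * k = Fintype.card V) (h3 : 3 ≤ (touched R)ᶜ.card)
    (h : GreedyInvariant m K (badGraph G B) (touched R)ᶜ) :
    ∃ u v, IsGoodMove G m K R B k u v := by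
  have hR : ∀ {u}, u ∈ (touched R)ᶜ → ∀ v, s(u, v) ∉ R := fun hu v =>
    mk_notMem_of_notMem_touched (Finset.mem_compl.1 hu) v
  have hcard : ∀ {u v : V}, u ∈ (touched R)ᶜ → v ∈ (touched R)ᶜ → u ≠ v →
      (((touched R)ᶜ.erase u).erase v).card + 2 = (touched R)ᶜ.card := by
    intro u v hu hv huv
    rw [Finset.card_erase_of_mem (Finset.mem_erase.2 ⟨huv.symm, hv⟩), Finset.card_erase_of_mem hu]
    omega
  rcases Nat.lt_or_ge (touched R)ᶜ.card 5 with h5 | h5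
  · have hsparse : (badGraph G B).degSum (touched R)ᶜ ≤ (touched R)ᶜ.card := by
      -- The other alternative needs `|U| ≥ K ≥ 400`.
      refine h.resolve_right fun h' => ?_
      have := h'.1
      have : 1 ≤ (m + 2) ^ 2 := Nat.one_le_pow _ _ (by omega)
      omega
    rcases Nat.lt_or_ge (touched R)ᶜ.card 4 with h4 | h4
    · obtain ⟨u, hu, v, hv, huv, hadj, -⟩ := (badGraph G B).exists_greedy_pair
        (U := (touched R)ᶜ) (Finset.card_pos.1 (by omega)) fun w hw => by
          have := (badGraph G B).two_mul_degIn_le_degSum hw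
          omega
      obtain ⟨hG, hBuv⟩ := (not_badGraph_adj huv).1 hadj
      refine ⟨u, v, hG, hR hu v, hBuv, Or.inr fun f _ _ hfB => Or.inr (Or.inl ?_)⟩
      have hc := hcard hu hv huv
      rw [compl_touched_insert]
      refine ⟨by omega, by omega, touched_ne_univ_of_two_mul_lt (k := k + 1) ?_ (by omega)⟩
      rw [Finset.card_insert_of_notMem hfB]
      omega
    · obtain ⟨a, ha, b, hb, hab, hadj, hdrop⟩ := greedy_step_of_sparse h4 hsparse
      obtain ⟨hG, hBab⟩ := (not_badGraph_adj hab).1 hadj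
      have hc := hcard ha hb hab
      have hrem := (badGraph G B).degSum_erase_erase ha hb hab hadj
      obtain ⟨c, d, hcd, hCD⟩ := Finset.card_eq_two.1
        (show (((touched R)ᶜ.erase a).erase b).card = 2 by omega)
      -- After the greedy pair is removed, the degree sum on the remaining two vertices is at most 4
      -- - 4 = 0.
      have hadj' : ¬ (badGraph G B).Adj c d := by
        intro hbad
        have h1 := (badGraph G B).two_mul_degIn_le_degSum (U := {c, d}) (u := c) (by simp)
        have h2 : 0 < (badGraph G B).degIn {c, d} c := by
          classical
          exact Finset.card_pos.2 ⟨d, Finset.mem_filter.2 ⟨by simp, hbad⟩⟩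
        rw [hCD] at hrem
        omega
      obtain ⟨hG', hBcd⟩ := (not_badGraph_adj hcd).1 hadj'
      have hcm : c ∈ ((touched R)ᶜ.erase a).erase b := by simp [hCD]
      have hdm : d ∈ ((touched R)ᶜ.erase a).erase b := by simp [hCD]
      simp only [Finset.mem_erase] at hcm hdm
      have hU : (touched R)ᶜ = {a, b, c, d} := by
        rw [← hCD, Finset.insert_erase (Finset.mem_erase.2 ⟨hab.symm, hb⟩),
          Finset.insert_erase ha]
      have hac := hcm.2.1.symm
      have had := hdm.2.1.symm
      have hbc := hcm.1.symm
      have hbd := hdm.1.symm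
      -- Red leaves a pair with a vertex already touched by Blue if `a` or `b` is one; otherwise he
      -- takes `s(a, b)` itself.
      by_cases h1 : a ∈ touched B
      · exact ⟨c, d, exists_goodMove_of_pairs hB (by omega)
          (by rw [hU]; ext; simp only [Finset.mem_insert, Finset.mem_singleton]; tauto)
          hG' hBcd hG hBab hac.symm hbc.symm had.symm hbd.symm (Or.inl h1)⟩
      by_cases h2 : b ∈ touched B
      · exact ⟨c, d, exists_goodMove_of_pairs hB (by omega)
          (by rw [hU]; ext; simp only [Finset.mem_insert, Finset.mem_singleton]; tauto)
          hG' hBcd hG.symm (by rwa [Sym2.eq_swap]) hbc.symm hac.symm hbd.symm had.symm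
          (Or.inl h2)⟩
      · exact ⟨a, b, exists_goodMove_of_pairs hB (by omega) hU hG hBab hG' hBcd hac had hbc hbd
          (Or.inr ⟨h1, h2⟩)⟩
  · obtain ⟨u, hu, v, hv, huv, hadj, hstep⟩ := h.step hK h5
    obtain ⟨hG, hBuv⟩ := (not_badGraph_adj huv).1 hadj
    refine ⟨u, v, hG, hR hu v, hBuv, Or.inr fun f hf _ _ => Or.inl ?_⟩
    have hc := hcard hu hv huv
    rw [compl_touched_insert]
    refine ⟨by omega, by omega, ?_⟩
    induction f with
    | _ x y =>
      have hxy : x ≠ y := (show G.Adj x y from hf).ne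
      refine hstep _ (degSum_badGraph_insert_le G B _ hxy) fun w => ?_
      have := degIn_badGraph_insert_le G B (((touched R)ᶜ.erase u).erase v) hxy w
      split_ifs at this <;> omega

theorem GoodPosition.exists_goodMove {G : SimpleGraph V} [DecidableRel G.Adj] {m K : ℕ}
    (hK : 400 * (m + 2) ^ 2 ≤ K) {R B : Finset (Sym2 V)} {k : ℕ} (hB : B.card ≤ k)
    (hdeg : ∀ v, Fintype.card V / 2 < G.degree v) (h : GoodPosition G m K R B k) :
    k < Fintype.card V / 2 + 1 ∧ touched R ≠ Finset.univ ∧ touched B ≠ Finset.univ ∧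
      ∃ u v, IsGoodMove G m K R B k u v := by
  have hne : ∀ {j : ℕ}, (touched R)ᶜ.card = j → 0 < j → touched R ≠ Finset.univ := by
    intro j hj h0 hR
    rw [hR] at hj
    simp at hj
    omega
  rcases h with ⟨hk, h3, hinv⟩ | ⟨h1, hk, hBu⟩ | ⟨hk, c, d, hU, hcd, hcdB⟩ | ⟨h2, hk, hblock⟩
  · exact ⟨by omega, hne rfl (by omega), touched_ne_univ_of_two_mul_lt hB (by omega),
      GreedyInvariant.exists_goodMove hK hB hk h3 hinv⟩
  · refine ⟨by omega, hne h1 one_pos, hBu, ?_⟩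
    obtain ⟨c, hc⟩ := Finset.card_eq_one.1 h1
    have hcR : c ∉ touched R := by rw [← Finset.mem_compl, hc]; simp
    obtain ⟨w, hw, hwR, hwB⟩ := exists_unclaimed_edge G hcR
      (hB.trans_lt (hk.trans_lt (hdeg c)))
    refine ⟨c, w, hw, hwR, hwB, Or.inl ?_⟩
    rw [← Finset.compl_eq_empty_iff, compl_touched_insert, hc]
    simp
  · have hcR : c ∉ touched R := by rw [← Finset.mem_compl, hU]; simp
    refine ⟨by omega, hne rfl (Finset.card_pos.2 ⟨c, Finset.mem_compl.2 hcR⟩),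
      touched_ne_univ_of_two_mul_lt hB (by omega),
      c, d, hcd, mk_notMem_of_notMem_touched hcR d, hcdB, Or.inl ?_⟩
    rw [← Finset.compl_eq_empty_iff, compl_touched_insert, hU]
    ext w
    simp
    tauto
  · refine ⟨by omega, hne h2 two_pos, touched_ne_univ_of_two_mul_lt hB (by omega), ?_⟩
    obtain ⟨c, hc⟩ := Finset.card_pos.1 (show 0 < (touched R)ᶜ.card by omega)
    obtain ⟨w, hw, hwR, hwB⟩ := exists_unclaimed_edge G (Finset.mem_compl.1 hc)
      (show B.card < G.degree c by have := hdeg c; omega)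
    refine ⟨c, w, hw, hwR, hwB, ?_⟩
    by_cases hcov : touched (insert s(c, w) R) = Finset.univ
    · exact Or.inl hcov
    -- One vertex is left for Red's last move, and the blocking condition says that Blue's reply
    -- does not win.
    · refine Or.inr fun f hf hfR _ => Or.inr (Or.inl ⟨?_, hk, ?_⟩)
      · have h3 : (touched (insert s(c, w) R))ᶜ.Nonempty := by
          rw [Finset.nonempty_iff_ne_empty]
          exact fun h => hcov (Finset.compl_eq_empty_iff _ |>.1 h)
        have h4 := Finset.card_pos.2 h3
        rw [compl_touched_insert] at h4 ⊢
        have h5 := Finset.card_le_card (Finset.erase_subset w ((touched R)ᶜ.erase c))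
        rw [Finset.card_erase_of_mem hc] at h5
        omega
      · exact hblock f hf fun h => hfR (Finset.mem_insert_of_mem h)

theorem redHasWinningStrategyWithin_of_goodPosition [Nonempty V] (G : SimpleGraph V)
    [DecidableRel G.Adj] {m K : ℕ} (hK : 400 * (m + 2) ^ 2 ≤ K)
    (hdeg : ∀ v, Fintype.card V / 2 < G.degree v) (h : GoodPosition G m K ∅ ∅ 0) :
    RedHasWinningStrategyWithin G.edgeSet (minDegreeWinningSets G 1)
      (Fintype.card V / 2 + 1) := by
  refine redHasWinningStrategyWithin_of_invariant
    (fun R B k => (R : Set (Sym2 V)) ⊆ G.edgeSet ∧ (B : Set (Sym2 V)) ⊆ G.edgeSet ∧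
      B.card ≤ k ∧ GoodPosition G m K R B k) ⟨by simp, by simp, by simp, h⟩ ?_
  rintro R B k ⟨hR, hB, hBk, hgood⟩
  obtain ⟨hk, hRu, hBu, u, v, hG, huvR, huvB, hmove⟩ := hgood.exists_goodMove hK hBk hdeg
  have hR' : ((insert s(u, v) R : Finset (Sym2 V)) : Set (Sym2 V)) ⊆ G.edgeSet := by
    rw [Finset.coe_insert]
    exact Set.insert_subset hG hR
  rw [completes_iff_touched_eq_univ G hR, completes_iff_touched_eq_univ G hB]
  refine ⟨hk, hRu, hBu, s(u, v), hG, huvR, huvB, ?_⟩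
  rw [completes_iff_touched_eq_univ G hR']
  by_cases hcov : touched (insert s(u, v) R) = Finset.univ
  · exact Or.inl hcov
  · refine Or.inr ⟨hcov, ?_, fun f hf hfR hfB => ⟨hR', ?_, ?_, ?_⟩⟩
    · obtain ⟨x, hx⟩ := not_forall.1 (mt Finset.eq_univ_iff_forall.2 hcov)
      obtain ⟨w, hw, hwR, hwB⟩ := exists_unclaimed_edge G hx
        (show B.card < G.degree x by have := hdeg x; omega)
      exact ⟨s(x, w), hw, hwR, hwB⟩
    · rw [Finset.coe_insert]
      exact Set.insert_subset hf hB
    · exact (Finset.card_insert_le _ _).trans (by omega)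
    · exact hmove.resolve_left hcov f hf hfR hfB

theorem degIn_badGraph_empty_le (G : SimpleGraph V) [DecidableRel G.Adj] (v : V) :
    (badGraph G ∅).degIn Finset.univ v + G.degree v ≤ Fintype.card V := by
  classical
  rw [← G.card_neighborFinset_eq_degree, degIn, ← Finset.card_union_of_disjoint]
  · exact Finset.card_le_univ _
  · rw [Finset.disjoint_left]
    intro w hw hw'
    simp [badGraph] at hw hw'
    exact hw.2 hw'

end MinDegreeGame

theorem mainTheorem6 (m : ℕ) (hm : 0 < m) :
    ∃ n₀ : ℕ, ∀ n : ℕ, n₀ ≤ n →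
      ∀ (V : Type*) [Fintype V] (G : SimpleGraph V) [DecidableRel G.Adj],
        Fintype.card V = n → n - m ≤ G.minDegree →
          StrongGame.RedHasWinningStrategyWithin
            G.edgeSet (minDegreeWinningSets G 1) (n / 2 + 1) := by
  obtain ⟨n₀, hn₀⟩ := SimpleGraph.exists_greedyInvariant_univ m (400 * (m + 2) ^ 2) le_rfl
  -- `2 * m + 3` makes every degree exceed `n / 2` and provides the three initial vertices.
  refine ⟨max n₀ (2 * m + 3), ?_⟩
  rintro n hn V _ G _ rfl hdeg
  classical
  obtain ⟨hn1, hn2⟩ := max_le_iff.1 hn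
  have : Nonempty V := Fintype.card_pos_iff.1 (by omega)
  have hdeg' : ∀ v, Fintype.card V - m ≤ G.degree v := fun v =>
    hdeg.trans (G.minDegree_le_degree v)
  refine MinDegreeGame.redHasWinningStrategyWithin_of_goodPosition G le_rfl (m := m)
    (fun v => by have := hdeg' v; omega) (Or.inl ⟨?_, ?_, ?_⟩)
  · simp [MinDegreeGame.touched]
  · simp [MinDegreeGame.touched]
    omega
  · have := hn₀ V (MinDegreeGame.badGraph G ∅) hn1 fun v => by
      have h1 := MinDegreeGame.degIn_badGraph_empty_le G v
      have h2 := hdeg' v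
      omega
    simpa [MinDegreeGame.touched] using this
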